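/- Let $M\subseteq\mathbb Z\times\mathbb Z$ be a finite set of moves (for example the knight moves together with $(0,0)$), and let $w$ be the largest absolute value of a coordinate of an element of $M$ ($w=0$ if $M=\emptyset$). For $q,n\in\mathbb N$ let $f_q(n)$ be the number of placements $(x_1,\dots,x_q)\in([n]^2)^q$ of $q$ labeled pieces such that $x_j-x_i\notin M$ for all $i\ne j$. **Definitions.** Let $g\in\mathbb Q[x]$ be integer-valued on $\mathbb Z$ and eventually nonnegative, $S=\{q\in\mathbb N: g(q)\ge 0\}$. A family of polynomials $F_q\in\mathbb Q[n]$, $q\in\mathbb N$, with $F_q=0$ for $q\notin S$ and, for $q\in S$, $F_q=\sum_{r\ge0}c_r(q)n^{g(q)-r}$ (where $c_r(q)=0$ for $r>g(q)$) is a *two-level polynomial of degree $g$ and infinite depth* if for each $q\in S$ either $\deg F_q=g(q)$ or $F_q=0$, and there are polynomials $\phi_r\in\mathbb Q[x]$ ($r\ge 0$) with $c_r(q)=\phi_r(q)$ for all $q\in S$ and all $r\ge0$. Functions $f_q$ ($q\in\mathbb N$) form an *eventual two-level polynomial of degree $g$ and infinite depth* if $f_q=0$ for $q\notin S$ and, for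 each $q\in S$, $f_q(n)$ agrees for all sufficiently large $n$ with a polynomial $F_q(n)$ of degree exactly $g(q)$, where the coefficients of the $F_q$ satisfy the same condition. The *attack graph* of a placement $x:[q]\to\mathbb Z^2$ has vertices $[q]$ and an edge $i\to j$ labeled $m\in M$ whenever $i\neq j$ and $x_j-x_i=m$. The attack graphs of all placements, ordered by inclusion, form a finite poset $\mathcal L_q$ with least element the empty graph $\hat 0$; write $\mu(G)=\mu_{\mathcal L_q}(\hat 0,G)$. A *crux* $G$ is an attack graph on some vertex set $[k]$ without isolated vertices; let $c$ be its number of connected components, $C_G$ its number of automorphisms (as a labeled directed graph), and $r=2(k-c)$ its *codegree*. For each component, the relative positions of its pieces are determined by $G$; let $\vec a_G\in\mathbb N^{2c}$ list, over all components, the largest difference of the first coordinates and the largest difference of the second coordinates of its pieces. For $\vec a\in\mathbb N^d$ put $g_d(\vec a;n)=(n-a_1)\cdots(n-a_d)$ if $n\ge\max_i a_i$ and $g_d(\vec a;n)=0$ otherwise. Write $(q)_k=q(q-1)\cdots(q-k+1)$. **Theorem.** $f_q(n)$ is an eventual two-level polynomial of degree $2q$ and infinite depth. Furthermore, for each $r$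 there are finitely many isomorphism classes of cruxes of codegree $r$; with representatives $G_{r,1},\dots,G_{r,m_r}$ and with $k_{r,t}$, $c_{r,t}$, $C_{r,t}$, $\vec a_{r,t}$, $\mu_{r,t}$ denoting the data of $G_{r,t}$, for all $q,n\in\mathbb N$ $$f_q(n)=n^{2q}+\sum_{\substack{r\ge2\\ r\text{ even}}}\ \sum_{t=1}^{m_r}\frac{\mu_{r,t}\,(q)_{k_{r,t}}}{C_{r,t}}\,n^{2q-2c_{r,t}-r}\,g_{2c_{r,t}}(\vec a_{r,t};n),$$ where summands with $k_{r,t}>q$ are zero (in particular all those with $r\geq 2q$), and $\max_i(\vec a_{r,t})_i\le wr/2$. For $n\ge wr/2$, each summand of codegree $r$ agrees with $$\frac{\mu_{r,t}(q)_{k_{r,t}}}{C_{r,t}}n^{2q-2c_{r,t}-r}\prod_{i=1}^{2c_{r,t}}\bigl(n-(\vec a_{r,t})_i\bigr),$$ which is a two-level polynomial of degree $2q-r$ and infinite depth (its degree is exactly $2q-r$ whenever $q\ge k_{r,t}$ and $\mu_{r,t}\ne0$). Consequently, for $n\ge wr/2$ the sum over $t$ of all summands of codegree $r$ agrees with a family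 of polynomials of degree at most $2q-r$ (zero if $2q<r$) whose coefficients of $n^{2q-r-s}$ are, for every $s\ge0$ and every $q$ with $2q\ge r$, the values at $q$ of a polynomial depending only on $r$ and $s$. -/

import Mathlib

open Polynomial

/-! ### Two-level polynomials -/

/-- A polynomial in `ℚ[x]` taking integer values at all integers. -/
def IsNumericalPolynomial (g : ℚ[X]) : Prop :=
  ∀ z : ℤ, ∃ m : ℤ, g.eval (z : ℚ) = (m : ℚ)

/-- `g(q) ≥ 0` for all sufficiently large natural numbers `q`. -/
def IsEventuallyNonneg (g : ℚ[X]) : Prop :=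
  ∀ᶠ q : ℕ in Filter.atTop, 0 ≤ g.eval (q : ℚ)

/-- The codegree `r` coefficient of `p` with respect to the degree `d`, i.e. the coefficient of
`x ^ (d - r)`, understood to be `0` when `r > d`. -/
noncomputable def codegreeCoeff (d r : ℕ) (p : ℚ[X]) : ℚ :=
  if r ≤ d then p.coeff (d - r) else 0

/-- There are polynomials `φ r` such that for every `q` with `g(q) ≥ 0` (the natural number `g(q)`
is called `d`) and every `r ≤ e(q)`, the codegree `r` coefficient of `F q`, with respect to the
degree `g(q)`, is `φ r` evaluated at `q`. Depths lie in `ℕ ∪ {-1, ∞}`, with `-1` encoded as `⊥`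
and `∞` as `⊤`. -/
def HasTwoLevelCoefficients (g : ℚ[X]) (e : ℕ → WithBot ℕ∞) (F : ℕ → ℚ[X]) : Prop :=
  ∃ φ : ℕ → ℚ[X], ∀ q d r : ℕ, g.eval (q : ℚ) = (d : ℚ) → ((r : ℕ∞) : WithBot ℕ∞) ≤ e q →
    codegreeCoeff d r (F q) = (φ r).eval (q : ℚ)

/-- Two-level polynomials of degree `g` and depth `e`. As usual for families such as
`q (q - 1) n ^ q`, the polynomial `F q` is allowed to be zero for some `q`. -/
structure IsTwoLevelPolynomial (g : ℚ[X]) (e : ℕ → WithBot ℕ∞) (F : ℕ → ℚ[X]) : Prop where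
  numerical : IsNumericalPolynomial g
  eventuallyNonneg : IsEventuallyNonneg g
  degree_eq : ∀ q d : ℕ, g.eval (q : ℚ) = (d : ℚ) → F q = 0 ∨ (F q).degree = (d : WithBot ℕ)
  eq_zero : ∀ q : ℕ, g.eval (q : ℚ) < 0 → F q = 0
  coefficients : HasTwoLevelCoefficients g e F

/-- Eventual two-level polynomials of degree `g` and depth `e`: sequences of functions `f q` that
agree, for sufficiently large `n`, with polynomials `F q` of degree exactly `g(q)` whose codegree
`r` coefficients are polynomial in `q` for `r ≤ e(q)`. -/
def IsEventualTwoLevelPolynomial (g : ℚ[X]) (e : ℕ → WithBot ℕ∞) (f : ℕ → ℕ → ℚ) : Prop :=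
  IsNumericalPolynomial g ∧ IsEventuallyNonneg g ∧
    (∀ q : ℕ, g.eval (q : ℚ) < 0 → ∀ n : ℕ, f q n = 0) ∧
    ∃ F : ℕ → ℚ[X],
      (∀ q d : ℕ, g.eval (q : ℚ) = (d : ℚ) → (F q).degree = (d : WithBot ℕ) ∧
        ∀ᶠ n : ℕ in Filter.atTop, f q n = (F q).eval (n : ℚ)) ∧
      HasTwoLevelCoefficients g e F

/-! ### Nonattacking placements -/

/-- The number of placements of `q` labeled pieces on the squares `{1, …, n}²` such that no piece
attacks another one. -/
noncomputable def nonattackingCount (M : Finset (ℤ × ℤ)) (q n : ℕ) : ℕ :=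
  ((Fintype.piFinset fun _ : Fin q => Finset.Icc (1 : ℤ) n ×ˢ Finset.Icc (1 : ℤ) n).filter
    fun x => ∀ i j, i ≠ j → x j - x i ∉ M).card

/-- The largest absolute value of a coordinate of a move (`0` if there are no moves). -/
def maxCoord (M : Finset (ℤ × ℤ)) : ℕ :=
  M.sup fun m => max m.1.natAbs m.2.natAbs

/-! ### Attack graphs -/

/-- The attack graph of a placement: the set of labeled edges `(i, j, m)` such that piece `i`
attacks piece `j ≠ i` by the move `m`. -/
def attackEdges (M : Finset (ℤ × ℤ)) {q : ℕ} (x : Fin q → ℤ × ℤ) :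
    Finset (Fin q × Fin q × (ℤ × ℤ)) :=
  (Finset.univ ×ˢ Finset.univ ×ˢ M).filter fun e => e.1 ≠ e.2.1 ∧ x e.2.1 - x e.1 = e.2.2

/-- The attack graphs on `q` pieces that are realized by some placement, ordered by inclusion. -/
abbrev AttackGraph (M : Finset (ℤ × ℤ)) (q : ℕ) : Type :=
  {G : Finset (Fin q × Fin q × (ℤ × ℤ)) // ∃ x : Fin q → ℤ × ℤ, attackEdges M x = G}

theorem attackGraph_finite (M : Finset (ℤ × ℤ)) (q : ℕ) : Finite (AttackGraph M q) := by
  have h : {G : Finset (Fin q × Fin q × (ℤ × ℤ)) |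
      ∃ x : Fin q → ℤ × ℤ, attackEdges M x = G}.Finite := by
    refine Set.Finite.subset
      (Finset.finite_toSet (Finset.univ ×ˢ Finset.univ ×ˢ M).powerset) ?_
    rintro G ⟨x, rfl⟩
    simp only [Finset.coe_powerset, Set.mem_preimage, Set.mem_powerset_iff, Finset.coe_subset]
    exact Finset.filter_subset _ _
  exact h.to_subtype

noncomputable instance attackGraphLocallyFinite (M : Finset (ℤ × ℤ)) (q : ℕ) :
    LocallyFiniteOrder (AttackGraph M q) := by
  classical
  haveI := attackGraph_finite M q
  haveI := Fintype.ofFinite (AttackGraph M q)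
  exact Fintype.toLocallyFiniteOrder

/-- The empty graph is an attack graph: put the pieces far apart. -/
theorem exists_attackEdges_eq_empty (M : Finset (ℤ × ℤ)) (q : ℕ) :
    ∃ x : Fin q → ℤ × ℤ, attackEdges M x = ∅ := by
  refine ⟨fun i => ((i : ℤ) * (maxCoord M + 1), 0), ?_⟩
  refine Finset.filter_eq_empty_iff.2 ?_
  rintro ⟨i, j, m⟩ he ⟨hij, hm⟩
  simp only [Finset.mem_product, Finset.mem_univ, true_and] at he hij hm
  have h1 : m.1.natAbs ≤ maxCoord M :=
    le_trans (le_max_left _ _) (Finset.le_sup (f := fun m : ℤ × ℤ => max m.1.natAbs m.2.natAbs) he)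
  rw [← hm] at h1
  have h2 : ((j : ℤ) - (i : ℤ)).natAbs * (maxCoord M + 1) ≤ maxCoord M := by
    have : ((j : ℤ) * (maxCoord M + 1) - (i : ℤ) * (maxCoord M + 1)).natAbs
        = ((j : ℤ) - (i : ℤ)).natAbs * (maxCoord M + 1) := by
      rw [← sub_mul, Int.natAbs_mul]
      congr 1
    rw [← this]
    exact h1
  have h3 : 1 ≤ ((j : ℤ) - (i : ℤ)).natAbs := by
    have : (i : ℕ) ≠ (j : ℕ) := fun h => hij (Fin.ext h)
    omega
  nlinarith

/-- The empty attack graph. -/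
def AttackGraph.empty (M : Finset (ℤ × ℤ)) (q : ℕ) : AttackGraph M q :=
  ⟨∅, exists_attackEdges_eq_empty M q⟩

open Classical in
/-- The Möbius number `μ([∅, G])` of an attack graph in the poset of attack graphs. -/
noncomputable def AttackGraph.mobius {M : Finset (ℤ × ℤ)} {q : ℕ} (G : AttackGraph M q) : ℤ :=
  IncidenceAlgebra.mu ℤ (AttackGraph.empty M q) G

/-! ### Cruxes and the terms of the formula -/

/-- A crux: an attack graph, on some number of pieces, without isolated vertices. -/
structure Crux (M : Finset (ℤ × ℤ)) where
  size : ℕ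
  graph : AttackGraph M size
  no_isolated : ∀ i, ∃ j m, (i, j, m) ∈ graph.1 ∨ (j, i, m) ∈ graph.1

namespace Crux

variable {M : Finset (ℤ × ℤ)}

/-- Isomorphism of labeled directed graphs. -/
def Iso (G H : Crux M) : Prop :=
  ∃ σ : Fin G.size ≃ Fin H.size, ∀ i j m, (i, j, m) ∈ G.graph.1 ↔ (σ i, σ j, m) ∈ H.graph.1

/-- The number of automorphisms of a crux. -/
noncomputable def autCard (G : Crux M) : ℕ :=
  Nat.card {σ : Equiv.Perm (Fin G.size) //
    ∀ i j m, (i, j, m) ∈ G.graph.1 ↔ (σ i, σ j, m) ∈ G.graph.1}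

/-- The underlying simple undirected graph. -/
def toSimpleGraph (G : Crux M) : SimpleGraph (Fin G.size) :=
  SimpleGraph.fromRel fun i j => ∃ m, (i, j, m) ∈ G.graph.1

/-- The connected components; all of them have at least two vertices. -/
abbrev Component (G : Crux M) : Type := G.toSimpleGraph.ConnectedComponent

noncomputable instance (G : Crux M) : Fintype G.Component :=
  Fintype.ofFinite _

/-- The number `c` of connected components. -/
noncomputable def numComponents (G : Crux M) : ℕ := Fintype.card G.Component

/-- The codegree `r = 2 (k - c)`, where `k` is the number of vertices. -/
noncomputable def codegree (G : Crux M) : ℕ := 2 * (G.size - G.numComponents)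

/-- A placement with attack graph `G`. It determines the relative positions of two pieces in the
same component, which do not depend on its choice. -/
noncomputable def position (G : Crux M) : Fin G.size → ℤ × ℤ := Classical.choose G.graph.2

open Classical in
/-- The largest difference of first coordinates within a component. -/
noncomputable def width (G : Crux M) (K : G.Component) : ℕ :=
  Finset.univ.sup fun p : K.supp × K.supp => ((G.position p.1).1 - (G.position p.2).1).toNat

open Classical in
/-- The largest difference of second coordinates within a component. -/
noncomputable def height (G : Crux M) (K : G.Component) : ℕ :=
  Finset.univ.sup fun p : K.supp × K.supp => ((G.position p.1).2 - (G.position p.2).2).toNat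

/-- The vector of length `2c` of the widths and heights of all components. -/
noncomputable def extents (G : Crux M) : G.Component ⊕ G.Component → ℕ :=
  Sum.elim G.width G.height

/-- The factor `μ(G) * (q)_k / |Aut G|`; here `(q)_k / |Aut G|` is the number of copies of `G`
inside `{1, …, q}`. -/
noncomputable def coeff (G : Crux M) (q : ℕ) : ℚ :=
  (G.graph.mobius : ℚ) * (q.descFactorial G.size : ℚ) / (G.autCard : ℚ)

end Crux

/-- The function `g_d(a; n)`. -/
noncomputable def truncatedProd {ι : Type*} [Fintype ι] (a : ι → ℕ) (n : ℕ) : ℚ :=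
  open Classical in if ∀ i, a i ≤ n then ∏ i, ((n : ℚ) - (a i : ℚ)) else 0

namespace Crux

variable {M : Finset (ℤ × ℤ)}

/-- The term of the formula for the nonattacking count contributed by all copies of `G`. The
exponent is `2 (q - k)`; when it would be negative, the coefficient vanishes. -/
noncomputable def term (G : Crux M) (q n : ℕ) : ℚ :=
  G.coeff q * (n : ℚ) ^ (2 * q - 2 * G.numComponents - G.codegree) * truncatedProd G.extents n

/-- The polynomial obtained from `term` by dropping the truncation. -/
noncomputable def termPoly (G : Crux M) (q : ℕ) : ℚ[X] :=
  C (G.coeff q) * X ^ (2 * q - 2 * G.numComponents - G.codegree) *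
    ∏ i, (X - C ((G.extents i : ℕ) : ℚ))

end Crux

/-!
Every placement has an attack graph, so Möbius inversion over the finite poset of attack graphs
expresses the number of nonattacking placements as the sum, over all attack graphs `A` on `q`
vertices, of `μ(A)` times the number of placements whose attack graph contains `A`.

Deleting the isolated vertices of `A` leaves a crux `G`, and both factors depend only on `G`. Pieces
without prescribed attacks can be put far away from all others, so the attack graphs below `A` are
those below `G` and `μ(A) = μ(G)`. A placement attacks at least as prescribed by `A` exactly when
it restricts to a translate of the position of each component of `G`; a component of width `a` and
height `b` has `(n - a) (n - b)` translates on the board (truncated subtraction), and each of the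
`q - k` isolated pieces is free to stand on any of the `n ^ 2` squares. Since `G` has
`(q)_k / |Aut G|` copies among the attack graphs on `q` vertices, grouping by isomorphism classes of
cruxes gives the formula.

A component of a crux with `k` vertices and `c` components contains paths of length at most `k - c`
between any two of its vertices, and each step changes a coordinate by at most `w`: this bounds the
extents by `w (k - c) = w r / 2`. The degree of a term in `n` is
`2 q - 2 c - r + 2 c = 2 q - r`, and its coefficients are polynomials in `q` because `q` enters only
through `(q)_k` once coefficients are counted from the formal leading power `n ^ (2 q)`.
-/

/-! ### Möbius inversion -/

theorem sum_mu_of_le {P R : Type*} [PartialOrder P] [LocallyFiniteOrder P] [Fintype P]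
    [DecidableEq P] [DecidableLE P] [Ring R] (b z : P) :
    ∑ y with y ≤ z, IncidenceAlgebra.mu R b y = if b = z then 1 else 0 := by
  rw [← IncidenceAlgebra.sum_Icc_mu_right]
  symm
  refine Finset.sum_subset (fun y hy => ?_) fun y hy hby => ?_
  · simpa using (Finset.mem_Icc.1 hy).2
  · refine IncidenceAlgebra.apply_eq_zero_of_not_le (fun h => hby ?_) _
    exact Finset.mem_Icc.2 ⟨h, (Finset.mem_filter.1 hy).2⟩

theorem card_filter_eq_sum_mu_mul_card_filter_le {α P R : Type*} [PartialOrder P]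
    [LocallyFiniteOrder P] [Fintype P] [DecidableEq P] [DecidableLE P] [Ring R]
    (s : Finset α) (f : α → P) (b : P) :
    ((s.filter fun x => b = f x).card : R) =
      ∑ y, IncidenceAlgebra.mu R b y * (s.filter fun x => y ≤ f x).card := by
  simp only [Finset.card_filter, Nat.cast_sum, Nat.cast_ite, Nat.cast_one, Nat.cast_zero,
    ← sum_mu_of_le (R := R), Finset.mul_sum, mul_ite, mul_one, mul_zero, Finset.sum_filter]
  exact Finset.sum_comm

theorem mu_apply_orderEmbedding {P Q R : Type*} [PartialOrder P] [LocallyFiniteOrder P]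
    [DecidableEq P] [PartialOrder Q] [LocallyFiniteOrder Q] [DecidableEq Q] [AddCommGroup R]
    [One R] (f : P ↪o Q) (hf : (Set.range f).OrdConnected) (a b : P) :
    IncidenceAlgebra.mu R (f a) (f b) = IncidenceAlgebra.mu R a b := by
  induction hcard : (Finset.Icc a b).card using Nat.strong_induction_on generalizing b with
  | _ N ih =>
    rcases eq_or_ne a b with rfl | hab
    · simp only [IncidenceAlgebra.mu_self]
    have hIco : Finset.Ico (f a) (f b) = (Finset.Ico a b).map f.toEmbedding := by
      apply Finset.coe_injective
      simpa using (f.image_Ico hf a b).symm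
    rw [IncidenceAlgebra.mu_eq_neg_sum_Ico_of_ne hab,
      IncidenceAlgebra.mu_eq_neg_sum_Ico_of_ne (f.injective.ne hab), hIco, Finset.sum_map]
    congr 1
    refine Finset.sum_congr rfl fun x hx => ih _ ?_ x rfl
    obtain ⟨hax, hxb⟩ := Finset.mem_Ico.1 hx
    rw [← hcard]
    exact Finset.card_lt_card (Finset.Icc_ssubset_Icc_right (hax.trans hxb.le) le_rfl hxb)

theorem card_filter_piFinset_comp {ι κ α : Type*} [Fintype ι] [DecidableEq ι] [Fintype κ]
    [DecidableEq κ] (ε : ι ↪ κ) (s : Finset α) (p : (ι → α) → Prop) [DecidablePred p] :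
    ((Fintype.piFinset fun _ : κ => s).filter fun x => p (x ∘ ε)).card =
      ((Fintype.piFinset fun _ : ι => s).filter p).card *
        s.card ^ (Fintype.card κ - Fintype.card ι) := by
  let e : ι ⊕ ↥(Set.range ε)ᶜ ≃ κ :=
    ((Equiv.ofInjective ε ε.injective).sumCongr (Equiv.refl _)).trans (Equiv.Set.sumCompl _)
  let split : (κ → α) ≃ (ι → α) × (↥(Set.range ε)ᶜ → α) :=
    (e.arrowCongr (Equiv.refl α)).symm.trans (Equiv.sumArrowEquivProdArrow _ _ _)
  have hrest : Fintype.card ↥(Set.range ε)ᶜ = Fintype.card κ - Fintype.card ι := by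
    rw [Fintype.card_compl_set, Set.card_range_of_injective ε.injective]
  have hpow : (Fintype.piFinset fun _ : ↥(Set.range ε)ᶜ => s).card =
      s.card ^ (Fintype.card κ - Fintype.card ι) := by
    rw [Fintype.card_piFinset, Finset.prod_const, Finset.card_univ, hrest]
  rw [← hpow, ← Finset.card_product]
  refine Finset.card_equiv split fun x => ?_
  have hmem : (∀ v, x v ∈ s) ↔ (∀ i, x (ε i) ∈ s) ∧ ∀ v : ↥(Set.range ε)ᶜ, x v ∈ s := by
    rw [← e.forall_congr_right, Sum.forall]
    rfl
  simp only [Finset.mem_filter, Finset.mem_product, Fintype.mem_piFinset, hmem]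
  exact and_right_comm

theorem exists_extension_lt_natAbs_sub {ι κ : Type*} [Finite ι] [Finite κ] (ε : ι ↪ κ)
    (a : ι → ℤ) (w : ℕ) :
    ∃ b : κ → ℤ, b ∘ ε = a ∧ ∀ u v, u ≠ v → v ∉ Set.range ε → w < (b u - b v).natAbs := by
  have := Fintype.ofFinite ι
  obtain ⟨N, ⟨e⟩⟩ := Finite.exists_equiv_fin κ
  let B : ℕ := (Finset.univ.sup fun i => (a i).natAbs) + w + 1
  have ha (i : ι) : (a i).natAbs + w < B := by
    have := Finset.le_sup (f := fun i => (a i).natAbs) (Finset.mem_univ i)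
    omega
  refine ⟨Function.extend ε a fun v => ((e v : ℤ) + 1) * B,
    funext fun i => ε.injective.extend_apply _ _ i, fun u v huv hv => ?_⟩
  rw [Function.extend_apply' _ _ _ hv]
  by_cases hu : u ∈ Set.range ε
  · obtain ⟨i, rfl⟩ := hu
    rw [ε.injective.extend_apply]
    have hB : (B : ℤ) ≤ ((e v : ℤ) + 1) * B := by nlinarith
    have := ha i
    omega
  · rw [Function.extend_apply' _ _ _ hu, ← sub_mul, Int.natAbs_mul, Int.natAbs_natCast]
    have hne : (e u : ℕ) ≠ e v := fun h => huv (e.injective (Fin.ext h))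
    have hpos : 1 ≤ ((e u : ℤ) + 1 - ((e v : ℤ) + 1)).natAbs := by omega
    exact (show w < B by omega).trans_le (Nat.le_mul_of_pos_left B hpos)

/-! ### Translates on the board -/

/-- The set of squares of the `n × n` board. -/
noncomputable def board (n : ℕ) : Finset (ℤ × ℤ) := Finset.Icc 1 (n : ℤ) ×ˢ Finset.Icc 1 (n : ℤ)

theorem card_board (n : ℕ) : (board n).card = n ^ 2 := by
  simp [board, sq]

/-- The largest difference of two values of `a`. -/
def spread {ι : Type*} [Fintype ι] (a : ι → ℤ) : ℕ :=
  Finset.univ.sup fun p : ι × ι => (a p.1 - a p.2).toNat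

theorem card_translates_subset_Icc {ι : Type*} [Fintype ι] [Nonempty ι] (a : ι → ℤ) (n : ℕ) :
    Nat.card {z : ℤ // ∀ i, a i + z ∈ Finset.Icc 1 (n : ℤ)} = n - spread a := by
  obtain ⟨lo, hlo⟩ := Finite.exists_min a
  obtain ⟨hi, hhi⟩ := Finite.exists_max a
  have hspread : spread a = (a hi - a lo).toNat :=
    le_antisymm
      (Finset.sup_le fun p _ => Int.toNat_le_toNat (sub_le_sub (hhi p.1) (hlo p.2)))
      (Finset.le_sup (f := fun p : ι × ι => (a p.1 - a p.2).toNat) (Finset.mem_univ (hi, lo)))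
  have hmem (z : ℤ) :
      (∀ i, a i + z ∈ Finset.Icc 1 (n : ℤ)) ↔ z ∈ Finset.Icc (1 - a lo) (n - a hi) := by
    simp only [Finset.mem_Icc]
    refine ⟨fun h => ?_, fun h i => ?_⟩
    · have := h lo
      have := h hi
      omega
    · have := hlo i
      have := hhi i
      omega
  have := hhi lo
  simp only [hmem, Nat.card_eq_fintype_card, Fintype.card_coe, Int.card_Icc]
  omega

theorem card_translates_subset_board {ι : Type*} [Fintype ι] [Nonempty ι] (a : ι → ℤ × ℤ)
    (n : ℕ) :
    Nat.card {z : ℤ × ℤ // ∀ i, a i + z ∈ board n} =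
      (n - spread fun i => (a i).1) * (n - spread fun i => (a i).2) := by
  rw [← card_translates_subset_Icc, ← card_translates_subset_Icc, ← Nat.card_prod]
  refine Nat.card_congr ((Equiv.subtypeEquivRight fun z => ?_).trans Equiv.subtypeProdEquivProd)
  simp only [board, Finset.mem_product, Prod.fst_add, Prod.snd_add, forall_and]

theorem truncatedProd_eq_prod_sub {ι : Type*} [Fintype ι] (a : ι → ℕ) (n : ℕ) :
    truncatedProd a n = ((∏ i, (n - a i) : ℕ) : ℚ) := by
  rw [truncatedProd]
  split_ifs with h
  · push_cast
    exact Finset.prod_congr rfl fun i _ => by rw [Nat.cast_sub (h i)]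
  · push Not at h
    obtain ⟨i, hi⟩ := h
    rw [Finset.prod_eq_zero (Finset.mem_univ i) (Nat.sub_eq_zero_of_le hi.le), Nat.cast_zero]

/-! ### Paths in components -/

theorem two_mul_card_connectedComponent_le {V : Type*} [Fintype V] {G : SimpleGraph V}
    [Fintype G.ConnectedComponent] (hG : ∀ v, ∃ w, G.Adj v w) :
    2 * Fintype.card G.ConnectedComponent ≤ Fintype.card V := by
  choose neighbor hadj using hG
  choose rep hrep using fun K : G.ConnectedComponent =>
    (K.exists_rep : ∃ v, G.connectedComponentMk v = K)
  have hneighbor (K : G.ConnectedComponent) :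
      G.connectedComponentMk (neighbor (rep K)) = K :=
    (SimpleGraph.ConnectedComponent.sound (hadj (rep K)).symm.reachable).trans (hrep K)
  have hinj : Function.Injective (Sum.elim rep fun K => neighbor (rep K)) := by
    refine Function.Injective.sumElim (Function.LeftInverse.injective hrep)
      (Function.LeftInverse.injective hneighbor) fun K L h => ?_
    obtain rfl : K = L := (hrep K).symm.trans ((congrArg _ h).trans (hneighbor L))
    exact (hadj (rep K)).ne h
  simpa [two_mul] using Fintype.card_le_of_injective _ hinj

theorem exists_walk_length_add_card_connectedComponent_le {V : Type*} [Fintype V]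
    {G : SimpleGraph V} [Fintype G.ConnectedComponent] {u v : V} (h : G.Reachable u v) :
    ∃ p : G.Walk u v, p.length + Fintype.card G.ConnectedComponent ≤ Fintype.card V := by
  classical
  obtain ⟨p, hp⟩ := h.exists_isPath
  have hcard : p.support.tail.toFinset.card = p.length := by
    rw [List.toFinset_card_of_nodup hp.support_nodup.tail, List.length_tail, p.length_support,
      Nat.add_sub_cancel]
  have hsurj : p.support.tail.toFinsetᶜ.image G.connectedComponentMk = Finset.univ := by
    refine Finset.eq_univ_iff_forall.2 fun K => Finset.mem_image.2 ?_
    rcases eq_or_ne (G.connectedComponentMk u) K with hu | hu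
    · refine ⟨u, ?_, hu⟩
      have hnodup := hp.support_nodup
      rw [← p.cons_tail_support] at hnodup
      simpa using (List.nodup_cons.1 hnodup).1
    · obtain ⟨w, rfl⟩ := K.exists_rep
      refine ⟨w, ?_, rfl⟩
      simp only [Finset.mem_compl, List.mem_toFinset]
      exact fun hw => hu (SimpleGraph.ConnectedComponent.sound
        (p.takeUntil w (List.mem_of_mem_tail hw)).reachable)
  have hle : Fintype.card G.ConnectedComponent ≤ p.support.tail.toFinsetᶜ.card := by
    rw [← Finset.card_univ, ← hsurj]
    exact Finset.card_image_le
  refine ⟨p, ?_⟩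
  have := p.support.tail.toFinset.card_compl_add_card
  omega

theorem natAbs_sub_le_mul_length {V : Type*} {G : SimpleGraph V} {f : V → ℤ} {w : ℕ}
    (hf : ∀ u v, G.Adj u v → (f u - f v).natAbs ≤ w) {u v : V} (p : G.Walk u v) :
    (f u - f v).natAbs ≤ w * p.length := by
  induction p with
  | nil => simp
  | @cons u v t h p ih =>
    have := hf u v h
    rw [SimpleGraph.Walk.length_cons, mul_add, mul_one]
    omega

theorem spread_supp_le {V : Type*} [Fintype V] {G : SimpleGraph V}
    [Fintype G.ConnectedComponent] {f : V → ℤ} {w : ℕ}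
    (hf : ∀ u v, G.Adj u v → (f u - f v).natAbs ≤ w) (K : G.ConnectedComponent)
    [Fintype K.supp] :
    spread (fun i : K.supp => f i) ≤
      w * (Fintype.card V - Fintype.card G.ConnectedComponent) := by
  refine Finset.sup_le fun ⟨i, j⟩ _ => ?_
  obtain ⟨p, hp⟩ := exists_walk_length_add_card_connectedComponent_le
    (SimpleGraph.ConnectedComponent.exact (i.2.trans j.2.symm))
  calc (f i - f j).toNat ≤ (f i - f j).natAbs := by omega
    _ ≤ w * p.length := natAbs_sub_le_mul_length hf p
    _ ≤ _ := Nat.mul_le_mul_left w (by omega)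

theorem exists_fin_representatives {α : Type*} (s : Setoid α) [Finite (Quotient s)] :
    ∃ (m : ℕ) (T : Fin m → α), ∀ a, ∃! t, s a (T t) := by
  obtain ⟨m, ⟨e⟩⟩ := Finite.exists_equiv_fin (Quotient s)
  refine ⟨m, fun t => (e.symm t).out, fun a => ?_⟩
  have key (t : Fin m) : s a (e.symm t).out ↔ t = e ⟦a⟧ := by
    rw [← Quotient.eq, Quotient.out_eq, eq_comm, Equiv.symm_apply_eq]
  simp only [key, existsUnique_eq]

/-! ### Coefficients counted from the top -/

theorem codegreeCoeff_add (d r : ℕ) (p p' : ℚ[X]) :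
    codegreeCoeff d r (p + p') = codegreeCoeff d r p + codegreeCoeff d r p' := by
  unfold codegreeCoeff
  split_ifs <;> simp

theorem codegreeCoeff_sum {ι : Type*} (d r : ℕ) (s : Finset ι) (p : ι → ℚ[X]) :
    codegreeCoeff d r (∑ i ∈ s, p i) = ∑ i ∈ s, codegreeCoeff d r (p i) := by
  unfold codegreeCoeff
  split_ifs <;> simp

theorem codegreeCoeff_C_mul (d r : ℕ) (a : ℚ) (p : ℚ[X]) :
    codegreeCoeff d r (C a * p) = a * codegreeCoeff d r p := by
  unfold codegreeCoeff
  split_ifs <;> simp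

theorem codegreeCoeff_X_pow_mul (a d r : ℕ) (p : ℚ[X]) :
    codegreeCoeff (a + d) r (X ^ a * p) = codegreeCoeff d r p := by
  simp only [codegreeCoeff, coeff_X_pow_mul', ← ite_and]
  refine ite_congr (propext (by omega)) (fun h => congrArg p.coeff (by omega)) fun _ => rfl

theorem codegreeCoeff_X_pow (d r : ℕ) :
    codegreeCoeff d r (X ^ d) = if r = 0 then 1 else 0 := by
  simp only [codegreeCoeff, coeff_X_pow, ← ite_and]
  exact if_congr (by omega) rfl rfl

theorem codegreeCoeff_add_add (d r s : ℕ) (p : ℚ[X]) :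
    codegreeCoeff (d + r) (s + r) p = codegreeCoeff d s p := by
  simp only [codegreeCoeff, Nat.add_sub_add_right, Nat.add_le_add_iff_right]

theorem codegreeCoeff_eq_zero_of_natDegree_add_lt {d s : ℕ} {p : ℚ[X]}
    (h : p.natDegree + s < d) : codegreeCoeff d s p = 0 := by
  rw [codegreeCoeff, if_pos (by omega), coeff_eq_zero_of_natDegree_lt (by omega)]

theorem eval_linear_eq_natCast_iff (q r d : ℕ) :
    (C 2 * X - C (r : ℚ)).eval (q : ℚ) = (d : ℚ) ↔ 2 * q = d + r := by
  simp only [eval_sub, eval_mul, eval_C, eval_X, sub_eq_iff_eq_add]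
  norm_cast

theorem eval_linear_neg_iff (q r : ℕ) :
    (C 2 * X - C (r : ℚ)).eval (q : ℚ) < 0 ↔ 2 * q < r := by
  simp only [eval_sub, eval_mul, eval_C, eval_X, sub_neg]
  norm_cast

theorem isNumericalPolynomial_linear (r : ℕ) :
    IsNumericalPolynomial (C 2 * X - C (r : ℚ)) := fun z => ⟨2 * z - r, by simp⟩

theorem isEventuallyNonneg_linear (r : ℕ) : IsEventuallyNonneg (C 2 * X - C (r : ℚ)) := by
  filter_upwards [Filter.eventually_ge_atTop r] with q hq
  rw [← not_lt, eval_linear_neg_iff]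
  omega

theorem hasTwoLevelCoefficients_of_codegreeCoeff_two_mul {φ F : ℕ → ℚ[X]}
    (hF : ∀ q s, codegreeCoeff (2 * q) s (F q) = (φ s).eval (q : ℚ)) (r : ℕ)
    (e : ℕ → WithBot ℕ∞) : HasTwoLevelCoefficients (C 2 * X - C (r : ℚ)) e F := by
  refine ⟨fun s => φ (s + r), fun q d s hd _ => ?_⟩
  rw [← hF, (eval_linear_eq_natCast_iff q r d).1 hd, codegreeCoeff_add_add]

/-! ### Attack graphs with isolated vertices -/

theorem mem_attackEdges {M : Finset (ℤ × ℤ)} {q : ℕ} {x : Fin q → ℤ × ℤ} {i j : Fin q}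
    {m : ℤ × ℤ} : (i, j, m) ∈ attackEdges M x ↔ m ∈ M ∧ i ≠ j ∧ x j - x i = m := by
  simp [attackEdges]

theorem natAbs_le_maxCoord {M : Finset (ℤ × ℤ)} {m : ℤ × ℤ} (hm : m ∈ M) :
    m.1.natAbs ≤ maxCoord M ∧ m.2.natAbs ≤ maxCoord M :=
  max_le_iff.1 (Finset.le_sup (f := fun m : ℤ × ℤ => max m.1.natAbs m.2.natAbs) hm)

/-- The map on labeled edges induced by an injection of the vertices. -/
def edgeEmbedding {k q : ℕ} (ε : Fin k ↪ Fin q) :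
    Fin k × Fin k × (ℤ × ℤ) ↪ Fin q × Fin q × (ℤ × ℤ) :=
  ε.prodMap (ε.prodMap (Function.Embedding.refl _))

theorem mem_map_edgeEmbedding {k q : ℕ} {ε : Fin k ↪ Fin q} {E : Finset (Fin k × Fin k × (ℤ × ℤ))}
    {i j : Fin q} {m : ℤ × ℤ} :
    (i, j, m) ∈ E.map (edgeEmbedding ε) ↔ ∃ a b, (a, b, m) ∈ E ∧ ε a = i ∧ ε b = j := by
  obtain ⟨m₁, m₂⟩ := m
  simp [edgeEmbedding]

theorem exists_attackEdges_eq_map (M : Finset (ℤ × ℤ)) {k q : ℕ} (ε : Fin k ↪ Fin q)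
    (p : Fin k → ℤ × ℤ) :
    ∃ x : Fin q → ℤ × ℤ, attackEdges M x = (attackEdges M p).map (edgeEmbedding ε) := by
  obtain ⟨b, hb, hfar⟩ := exists_extension_lt_natAbs_sub ε (fun i => (p i).1) (maxCoord M)
  let x : Fin q → ℤ × ℤ := fun v => (b v, Function.extend ε (fun i => (p i).2) 0 v)
  have hx (i : Fin k) : x (ε i) = p i :=
    Prod.ext (congrFun hb i) (ε.injective.extend_apply (fun i => (p i).2) 0 i)
  have hrange {u v : Fin q} {m : ℤ × ℤ} (h : (u, v, m) ∈ attackEdges M x) :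
      u ∈ Set.range ε ∧ v ∈ Set.range ε := by
    obtain ⟨hm, huv, rfl⟩ := mem_attackEdges.1 h
    have hle : (b v - b u).natAbs ≤ maxCoord M := (natAbs_le_maxCoord hm).1
    exact ⟨by_contra fun hu => (hfar v u huv.symm hu).not_ge hle,
      by_contra fun hv => (hfar u v huv hv).not_ge (by omega)⟩
  refine ⟨x, Finset.ext fun ⟨u, v, m⟩ => ?_⟩
  rw [mem_map_edgeEmbedding]
  constructor
  · intro h
    obtain ⟨⟨i, rfl⟩, j, rfl⟩ := hrange h
    refine ⟨i, j, ?_, rfl, rfl⟩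
    rwa [mem_attackEdges, hx, hx, ε.injective.ne_iff, ← mem_attackEdges] at h
  · rintro ⟨i, j, h, rfl, rfl⟩
    rwa [mem_attackEdges, hx, hx, ε.injective.ne_iff, ← mem_attackEdges]

namespace AttackGraph

variable {M : Finset (ℤ × ℤ)} {k l q : ℕ}

/-- The attack graph of a placement, as an element of the poset of attack graphs. -/
def ofPlacement (x : Fin q → ℤ × ℤ) : AttackGraph M q := ⟨attackEdges M x, x, rfl⟩

theorem empty_eq_ofPlacement_iff {x : Fin q → ℤ × ℤ} :
    empty M q = ofPlacement x ↔ ∀ i j, i ≠ j → x j - x i ∉ M := by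
  rw [Subtype.ext_iff, eq_comm]
  refine Finset.eq_empty_iff_forall_notMem.trans ⟨fun h i j hij hm => ?_, ?_⟩
  · exact h (i, j, _) (mem_attackEdges.2 ⟨hm, hij, rfl⟩)
  · rintro h ⟨i, j, m⟩ he
    obtain ⟨hm, hij, rfl⟩ := mem_attackEdges.1 he
    exact h i j hij hm

/-- The set of non-isolated vertices. -/
def support (A : AttackGraph M q) : Set (Fin q) :=
  {i | ∃ j m, (i, j, m) ∈ A.1 ∨ (j, i, m) ∈ A.1}

theorem support_mono : Monotone (support (M := M) (q := q)) :=
  fun _ _ h _ ⟨j, m, hm⟩ => ⟨j, m, hm.imp (h ·) (h ·)⟩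

theorem support_eq_empty_iff {A : AttackGraph M q} : A.support = ∅ ↔ A = empty M q := by
  refine ⟨fun h => Subtype.ext (Finset.eq_empty_of_forall_notMem fun ⟨i, j, m⟩ he => ?_), ?_⟩
  · exact Set.eq_empty_iff_forall_notMem.1 h i ⟨j, m, .inl he⟩
  · rintro rfl
    simp [support, empty]

/-- The image of an attack graph under an injection of the vertices; the vertices outside the range
are isolated. -/
def map (ε : Fin k ↪ Fin q) : AttackGraph M k ↪o AttackGraph M q :=
  OrderEmbedding.ofMapLEIff
    (fun A => ⟨A.1.map (edgeEmbedding ε), by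
      obtain ⟨p, hp⟩ := A.2
      exact hp ▸ exists_attackEdges_eq_map M ε p⟩)
    fun _ _ => Finset.map_subset_map

theorem mem_map {ε : Fin k ↪ Fin q} {A : AttackGraph M k} {i j : Fin q} {m : ℤ × ℤ} :
    (i, j, m) ∈ (map ε A).1 ↔ ∃ a b, (a, b, m) ∈ A.1 ∧ ε a = i ∧ ε b = j :=
  mem_map_edgeEmbedding

theorem apply_mem_map {ε : Fin k ↪ Fin q} {A : AttackGraph M k} {i j : Fin k} {m : ℤ × ℤ} :
    (ε i, ε j, m) ∈ (map ε A).1 ↔ (i, j, m) ∈ A.1 :=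
  Finset.mem_map' (edgeEmbedding ε) (a := (i, j, m))

theorem map_trans (ε : Fin k ↪ Fin l) (δ : Fin l ↪ Fin q) (A : AttackGraph M k) :
    map (ε.trans δ) A = map δ (map ε A) :=
  Subtype.ext (Finset.map_map (edgeEmbedding ε) (edgeEmbedding δ) A.1).symm

theorem map_empty (ε : Fin k ↪ Fin q) : map ε (empty M k) = empty M q :=
  Subtype.ext (Finset.map_empty _)

theorem support_map (ε : Fin k ↪ Fin q) (A : AttackGraph M k) :
    (map ε A).support = ε '' A.support := by
  ext i
  constructor
  · rintro ⟨j, m, h | h⟩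
    · obtain ⟨a, b, hab, rfl, -⟩ := mem_map.1 h
      exact ⟨a, ⟨b, m, .inl hab⟩, rfl⟩
    · obtain ⟨a, b, hab, -, rfl⟩ := mem_map.1 h
      exact ⟨b, ⟨a, m, .inr hab⟩, rfl⟩
  · rintro ⟨a, ⟨b, m, h⟩, rfl⟩
    exact ⟨ε b, m, h.imp apply_mem_map.2 apply_mem_map.2⟩

theorem mem_range_map_iff {ε : Fin k ↪ Fin q} {A : AttackGraph M q} :
    A ∈ Set.range (map ε) ↔ A.support ⊆ Set.range ε := by
  constructor
  · rintro ⟨B, rfl⟩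
    rw [support_map]
    exact Set.image_subset_range _ _
  · obtain ⟨A, x, rfl⟩ := A
    refine fun h => ⟨ofPlacement (x ∘ ε), Subtype.ext (Finset.ext fun ⟨i, j, m⟩ => ?_)⟩
    constructor
    · rw [mem_map]
      rintro ⟨a, b, hab, rfl, rfl⟩
      obtain ⟨hm, hne, hd⟩ := mem_attackEdges.1 hab
      exact mem_attackEdges.2 ⟨hm, ε.injective.ne hne, hd⟩
    · intro hij
      obtain ⟨a, rfl⟩ := h ⟨j, m, .inl hij⟩
      obtain ⟨b, rfl⟩ := h ⟨_, m, .inr hij⟩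
      obtain ⟨hm, hne, hd⟩ := mem_attackEdges.1 hij
      exact apply_mem_map.2 (mem_attackEdges.2 ⟨hm, ne_of_apply_ne ε hne, hd⟩)

theorem map_le_ofPlacement_iff {ε : Fin k ↪ Fin q} {A : AttackGraph M k}
    {x : Fin q → ℤ × ℤ} : map ε A ≤ ofPlacement x ↔ A ≤ ofPlacement (x ∘ ε) := by
  have hcomp (e : Fin k × Fin k × (ℤ × ℤ)) :
      edgeEmbedding ε e ∈ attackEdges M x ↔ e ∈ attackEdges M (x ∘ ε) := by
    simp [attackEdges, edgeEmbedding]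
  exact Finset.forall_mem_map.trans (forall₂_congr fun e _ => hcomp e)

theorem mobius_map (ε : Fin k ↪ Fin q) (A : AttackGraph M k) : (map ε A).mobius = A.mobius := by
  rw [mobius, ← map_empty ε]
  refine mu_apply_orderEmbedding (map ε) ⟨?_⟩ _ _
  rintro A - B hB C ⟨-, hCB⟩
  rw [mem_range_map_iff] at hB ⊢
  exact (support_mono hCB).trans hB

theorem mobius_empty : (empty M q).mobius = 1 := IncidenceAlgebra.mu_self _

open Classical in
/-- The number of placements of `q` pieces on the `n × n` board with at least the attacks of `A`. -/
noncomputable def superCount (A : AttackGraph M q) (n : ℕ) : ℕ :=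
  ((Fintype.piFinset fun _ : Fin q => board n).filter fun x => A ≤ ofPlacement x).card

theorem superCount_map (ε : Fin k ↪ Fin q) (A : AttackGraph M k) (n : ℕ) :
    (map ε A).superCount n = A.superCount n * n ^ (2 * (q - k)) := by
  classical
  simp only [superCount, map_le_ofPlacement_iff]
  rw [card_filter_piFinset_comp ε (board n) fun x => A ≤ ofPlacement x, card_board,
    Fintype.card_fin, Fintype.card_fin, ← pow_mul]

theorem superCount_empty (n : ℕ) : (empty M q).superCount n = n ^ (2 * q) := by
  classical
  have hle (x : Fin q → ℤ × ℤ) : empty M q ≤ ofPlacement x := Finset.empty_subset _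
  simp [superCount, hle, card_board, pow_mul]

end AttackGraph

theorem nonattackingCount_eq_sum_mobius (M : Finset (ℤ × ℤ)) (q n : ℕ)
    [Fintype (AttackGraph M q)] :
    (nonattackingCount M q n : ℤ) = ∑ A : AttackGraph M q, A.mobius * A.superCount n := by
  classical
  simp only [AttackGraph.superCount, AttackGraph.mobius]
  rw [← card_filter_eq_sum_mu_mul_card_filter_le]
  simp only [AttackGraph.empty_eq_ofPlacement_iff, nonattackingCount, board]

/-! ### Placements containing a crux -/

namespace Crux

section Position

variable {M : Finset (ℤ × ℤ)} (G : Crux M)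

theorem mem_graph_iff {i j : Fin G.size} {m : ℤ × ℤ} :
    (i, j, m) ∈ G.graph.1 ↔ m ∈ M ∧ i ≠ j ∧ G.position j - G.position i = m := by
  rw [← mem_attackEdges, position, Classical.choose_spec G.graph.2]

theorem adj_iff {i j : Fin G.size} :
    G.toSimpleGraph.Adj i j ↔ ∃ m, (i, j, m) ∈ G.graph.1 ∨ (j, i, m) ∈ G.graph.1 := by
  rw [toSimpleGraph, SimpleGraph.fromRel_adj, ← exists_or]
  refine and_iff_right_of_imp ?_
  rintro ⟨m, h | h⟩
  · exact (G.mem_graph_iff.1 h).2.1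
  · exact (G.mem_graph_iff.1 h).2.1.symm

theorem graph_le_ofPlacement_iff (y : Fin G.size → ℤ × ℤ) :
    G.graph ≤ AttackGraph.ofPlacement y ↔
      ∃ z : G.Component → ℤ × ℤ,
        ∀ i, G.position i + z (G.toSimpleGraph.connectedComponentMk i) = y i := by
  constructor
  · intro h
    have hadj (i j : Fin G.size) (hij : G.toSimpleGraph.Adj i j) :
        y i - G.position i = y j - G.position j := by
      obtain ⟨m, hm | hm⟩ := G.adj_iff.1 hij
      · linear_combination (G.mem_graph_iff.1 hm).2.2 - (mem_attackEdges.1 (h hm)).2.2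
      · linear_combination (mem_attackEdges.1 (h hm)).2.2 - (G.mem_graph_iff.1 hm).2.2
    refine ⟨SimpleGraph.ConnectedComponent.lift (fun i => y i - G.position i)
      fun i j p _ => ?_, fun i => add_sub_cancel _ _⟩
    exact p.rec (motive := fun i j _ => y i - G.position i = y j - G.position j)
      rfl fun hij _ ih => (hadj _ _ hij).trans ih
  · rintro ⟨z, hz⟩ ⟨i, j, m⟩ he
    obtain ⟨hm, hne, hp⟩ := G.mem_graph_iff.1 he
    have hcomp : G.toSimpleGraph.connectedComponentMk i =
        G.toSimpleGraph.connectedComponentMk j :=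
      SimpleGraph.ConnectedComponent.sound (G.adj_iff.2 ⟨m, .inl he⟩).reachable
    refine mem_attackEdges.2 ⟨hm, hne, ?_⟩
    rw [← hz i, ← hz j, hcomp, add_sub_add_right_eq_sub, hp]

theorem superCount_eq (n : ℕ) : G.graph.superCount n = ∏ i, (n - G.extents i) := by
  classical
  let place (z : G.Component → ℤ × ℤ) (i : Fin G.size) : ℤ × ℤ :=
    G.position i + z (G.toSimpleGraph.connectedComponentMk i)
  have hinj : Function.Injective place := fun z z' h => funext fun K => by
    obtain ⟨i, rfl⟩ := K.exists_rep
    exact add_left_cancel (congrFun h i)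
  have hboard (z : G.Component → ℤ × ℤ) :
      (∀ i, place z i ∈ board n) ↔ ∀ K, ∀ i : K.supp, G.position i + z K ∈ board n :=
    ⟨fun h K ⟨i, hi⟩ => hi ▸ h i, fun h i => h _ ⟨i, rfl⟩⟩
  have e : {y : Fin G.size → ℤ × ℤ // (∀ i, y i ∈ board n) ∧
        G.graph ≤ AttackGraph.ofPlacement y} ≃
      ((K : G.Component) → {z : ℤ × ℤ // ∀ i : K.supp, G.position i + z ∈ board n}) := by
    refine Equiv.trans (Equiv.ofBijective (fun z => ⟨place z.1, (hboard z.1).2 z.2,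
      (G.graph_le_ofPlacement_iff _).2 ⟨z.1, fun _ => rfl⟩⟩) ⟨fun z z' h => ?_, ?_⟩).symm
      Equiv.subtypePiEquivPi
    · exact Subtype.ext (hinj (congrArg Subtype.val h))
    · rintro ⟨y, hy, hle⟩
      obtain ⟨z, hz⟩ := (G.graph_le_ofPlacement_iff y).1 hle
      obtain rfl : place z = y := funext hz
      exact ⟨⟨z, (hboard z).1 hy⟩, rfl⟩
  have hcard : G.graph.superCount n = Nat.card {y : Fin G.size → ℤ × ℤ //
      (∀ i, y i ∈ board n) ∧ G.graph ≤ AttackGraph.ofPlacement y} :=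
    (Nat.subtype_card _ fun y => by rw [Finset.mem_filter, Fintype.mem_piFinset]).symm
  rw [hcard, Nat.card_congr e, Nat.card_pi, Fintype.prod_sum_type, ← Finset.prod_mul_distrib]
  refine Finset.prod_congr rfl fun K _ => ?_
  have := K.nonempty_supp.to_subtype
  exact card_translates_subset_board (fun i : K.supp => G.position i) n

end Position

section Codegree

variable {M : Finset (ℤ × ℤ)} (G : Crux M)

theorem two_mul_numComponents_le : 2 * G.numComponents ≤ G.size := by
  refine (two_mul_card_connectedComponent_le fun i => ?_).trans_eq (Fintype.card_fin _)
  obtain ⟨j, hj⟩ := G.no_isolated i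
  exact ⟨j, G.adj_iff.2 hj⟩

theorem codegree_add_two_mul_numComponents :
    G.codegree + 2 * G.numComponents = 2 * G.size := by
  have := G.two_mul_numComponents_le
  rw [codegree]
  omega

theorem size_le_codegree : G.size ≤ G.codegree := by
  have := G.two_mul_numComponents_le
  have := G.codegree_add_two_mul_numComponents
  omega

theorem codegree_le_two_mul_size : G.codegree ≤ 2 * G.size :=
  Nat.mul_le_mul_left 2 (Nat.sub_le _ _)

theorem even_codegree : Even G.codegree := even_two_mul _

theorem natAbs_position_sub_le {i j : Fin G.size} (h : G.toSimpleGraph.Adj i j) :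
    ((G.position i).1 - (G.position j).1).natAbs ≤ maxCoord M ∧
      ((G.position i).2 - (G.position j).2).natAbs ≤ maxCoord M := by
  obtain ⟨m, hm | hm⟩ := G.adj_iff.1 h <;>
  · obtain ⟨hmM, -, rfl⟩ := G.mem_graph_iff.1 hm
    have := natAbs_le_maxCoord hmM
    simp only [Prod.fst_sub, Prod.snd_sub] at this
    omega

theorem two_mul_extents_le (i : G.Component ⊕ G.Component) :
    2 * G.extents i ≤ maxCoord M * G.codegree := by
  classical
  have hle : G.extents i ≤ maxCoord M * (G.size - G.numComponents) := by
    rw [← Fintype.card_fin G.size]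
    rcases i with K | K
    · exact spread_supp_le (f := fun i => (G.position i).1)
        (fun i j h => (G.natAbs_position_sub_le h).1) K
    · exact spread_supp_le (f := fun i => (G.position i).2)
        (fun i j h => (G.natAbs_position_sub_le h).2) K
  rw [codegree, mul_left_comm]
  exact Nat.mul_le_mul_left 2 hle

theorem finite_codegree_eq (M : Finset (ℤ × ℤ)) (r : ℕ) :
    Finite {G : Crux M // G.codegree = r} := by
  have := attackGraph_finite M
  refine Finite.of_injective (β := Σ k : Fin (r + 1), AttackGraph M k)
    (fun G => ⟨⟨G.1.size, Nat.lt_succ_of_le (G.1.size_le_codegree.trans G.2.le)⟩, G.1.graph⟩) ?_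
  rintro ⟨⟨k, A, hA⟩, hG⟩ ⟨⟨l, B, hB⟩, hH⟩ h
  simp only [Sigma.mk.injEq, Fin.mk.injEq] at h
  obtain ⟨rfl, h⟩ := h
  obtain rfl := eq_of_heq h
  rfl

end Codegree

end Crux

/-! ### Copies of cruxes -/

theorem AttackGraph.map_equiv_eq_iff {M : Finset (ℤ × ℤ)} {k q : ℕ} {σ : Fin k ≃ Fin q}
    {A : AttackGraph M k} {B : AttackGraph M q} :
    map σ.toEmbedding A = B ↔ ∀ i j m, (i, j, m) ∈ A.1 ↔ (σ i, σ j, m) ∈ B.1 := by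
  constructor
  · rintro rfl i j m
    exact apply_mem_map.symm
  · refine fun h => Subtype.ext (Finset.ext fun ⟨i, j, m⟩ => ?_)
    obtain ⟨i, rfl⟩ := σ.surjective i
    obtain ⟨j, rfl⟩ := σ.surjective j
    exact apply_mem_map.trans (h i j m)

namespace Crux

section Copies

variable {M : Finset (ℤ × ℤ)} {q : ℕ}

theorem iso_iff {G H : Crux M} :
    G.Iso H ↔ ∃ σ : Fin G.size ≃ Fin H.size, AttackGraph.map σ.toEmbedding G.graph = H.graph :=
  exists_congr fun _ => AttackGraph.map_equiv_eq_iff.symm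

theorem Iso.refl (G : Crux M) : G.Iso G := ⟨Equiv.refl _, fun _ _ _ => Iff.rfl⟩

theorem Iso.symm {G H : Crux M} : G.Iso H → H.Iso G := fun ⟨σ, hσ⟩ =>
  ⟨σ.symm, fun i j m => by rw [hσ, σ.apply_symm_apply, σ.apply_symm_apply]⟩

theorem Iso.trans {G H K : Crux M} : G.Iso H → H.Iso K → G.Iso K := fun ⟨σ, hσ⟩ ⟨τ, hτ⟩ =>
  ⟨σ.trans τ, fun i j m => (hσ i j m).trans (hτ _ _ m)⟩

theorem Iso.codegree_eq {G H : Crux M} (h : G.Iso H) : G.codegree = H.codegree := by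
  obtain ⟨σ, hσ⟩ := h
  let e : G.toSimpleGraph ≃g H.toSimpleGraph := ⟨σ, by simp [adj_iff, hσ]⟩
  rw [codegree, codegree, numComponents, numComponents,
    Fintype.card_congr e.connectedComponentEquiv, Fin.equiv_iff_eq.1 ⟨σ⟩]

theorem support_graph (G : Crux M) : G.graph.support = Set.univ :=
  Set.eq_univ_of_forall G.no_isolated

theorem exists_equiv_of_map_eq {G H : Crux M} {ε : Fin G.size ↪ Fin q} {δ : Fin H.size ↪ Fin q}
    (h : AttackGraph.map ε G.graph = AttackGraph.map δ H.graph) :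
    ∃ σ : Fin G.size ≃ Fin H.size, σ.toEmbedding.trans δ = ε ∧
      AttackGraph.map σ.toEmbedding G.graph = H.graph := by
  have hrange : Set.range ε = Set.range δ := by
    simpa only [AttackGraph.support_map, support_graph, Set.image_univ] using
      congrArg AttackGraph.support h
  let σ : Fin G.size ≃ Fin H.size := (Equiv.ofInjective ε ε.injective).trans
    ((Equiv.setCongr hrange).trans (Equiv.ofInjective δ δ.injective).symm)
  have hσ : σ.toEmbedding.trans δ = ε :=
    DFunLike.ext _ _ fun i => Equiv.apply_ofInjective_symm δ.injective _
  refine ⟨σ, hσ, (AttackGraph.map δ).injective ?_⟩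
  rw [← AttackGraph.map_trans, hσ, h]

open Classical in
/-- The attack graphs on `q` pieces that become isomorphic to `G` when their isolated vertices are
removed. -/
noncomputable def copies (G : Crux M) (q : ℕ) : Finset (AttackGraph M q) :=
  Finset.univ.image fun ε : Fin G.size ↪ Fin q => AttackGraph.map ε G.graph

theorem mem_copies {G : Crux M} {A : AttackGraph M q} :
    A ∈ G.copies q ↔ ∃ ε : Fin G.size ↪ Fin q, AttackGraph.map ε G.graph = A := by
  simp [copies]

theorem exists_mem_copies (A : AttackGraph M q) : ∃ G : Crux M, A ∈ G.copies q := by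
  classical
  obtain ⟨k, ε, hrange⟩ : ∃ k, ∃ ε : Fin k ↪ Fin q, Set.range ε = A.support :=
    ⟨_, (A.support.toFinset.orderEmbOfFin rfl).toEmbedding, by simp⟩
  obtain ⟨B, rfl⟩ := AttackGraph.mem_range_map_iff.2 hrange.ge
  refine ⟨⟨k, B, fun i => ?_⟩, mem_copies.2 ⟨ε, rfl⟩⟩
  have hi := hrange.le ⟨i, rfl⟩
  rw [AttackGraph.support_map] at hi
  exact ε.injective.mem_set_image.1 hi

theorem map_mem_copies_iff {G H : Crux M} (ε : Fin G.size ↪ Fin q) :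
    AttackGraph.map ε G.graph ∈ H.copies q ↔ G.Iso H := by
  rw [mem_copies]
  constructor
  · rintro ⟨δ, hδ⟩
    obtain ⟨σ, -, hσ⟩ := exists_equiv_of_map_eq hδ.symm
    exact iso_iff.2 ⟨σ, hσ⟩
  · intro h
    obtain ⟨σ, hσ⟩ := iso_iff.1 h.symm
    exact ⟨σ.toEmbedding.trans ε, by rw [AttackGraph.map_trans, hσ]⟩

theorem eq_empty_iff_codegree_eq_zero {G : Crux M} {A : AttackGraph M q}
    (hA : A ∈ G.copies q) : A = AttackGraph.empty M q ↔ G.codegree = 0 := by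
  obtain ⟨ε, rfl⟩ := mem_copies.1 hA
  have hle := G.size_le_codegree
  have hge := G.codegree_le_two_mul_size
  rw [← AttackGraph.support_eq_empty_iff, AttackGraph.support_map, support_graph,
    Set.image_eq_empty, Set.univ_eq_empty_iff, ← Fintype.card_eq_zero_iff, Fintype.card_fin]
  omega

theorem codegree_le_of_mem_copies {G : Crux M} {A : AttackGraph M q} (hA : A ∈ G.copies q) :
    G.codegree ≤ 2 * q := by
  obtain ⟨ε, -⟩ := mem_copies.1 hA
  have : G.size ≤ q := by simpa using Fintype.card_le_of_embedding ε
  have := G.codegree_le_two_mul_size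
  omega

theorem card_filter_map_eq_map {G : Crux M} (ε : Fin G.size ↪ Fin q)
    [DecidableEq (AttackGraph M q)] :
    (Finset.univ.filter fun δ : Fin G.size ↪ Fin q =>
      AttackGraph.map δ G.graph = AttackGraph.map ε G.graph).card = G.autCard := by
  rw [← Fintype.card_subtype, ← Nat.card_eq_fintype_card, autCard]
  simp only [← AttackGraph.map_equiv_eq_iff]
  refine (Nat.card_congr (Equiv.ofBijective
    (fun σ => ⟨σ.1.toEmbedding.trans ε, by rw [AttackGraph.map_trans, σ.2]⟩) ⟨?_, ?_⟩)).symm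
  · exact fun σ τ h => Subtype.ext (Equiv.ext fun i =>
      ε.injective (DFunLike.congr_fun (congrArg Subtype.val h) i))
  · rintro ⟨δ, hδ⟩
    obtain ⟨σ, hσε, hσ⟩ := exists_equiv_of_map_eq hδ
    exact ⟨⟨σ, hσ⟩, Subtype.ext hσε⟩

theorem card_copies_mul_autCard (G : Crux M) (q : ℕ) :
    (G.copies q).card * G.autCard = q.descFactorial G.size := by
  classical
  have hcard : (Finset.univ : Finset (Fin G.size ↪ Fin q)).card = q.descFactorial G.size := by
    rw [Finset.card_univ, Fintype.card_embedding_eq, Fintype.card_fin, Fintype.card_fin]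
  rw [← hcard, Finset.card_eq_sum_card_image fun ε => AttackGraph.map ε G.graph]
  refine (Finset.sum_const_nat fun A hA => ?_).symm
  obtain ⟨ε, -, rfl⟩ := Finset.mem_image.1 hA
  exact card_filter_map_eq_map ε

theorem autCard_pos (G : Crux M) : 0 < G.autCard := by
  have : Nonempty {σ : Equiv.Perm (Fin G.size) //
    ∀ i j m, (i, j, m) ∈ G.graph.1 ↔ (σ i, σ j, m) ∈ G.graph.1} :=
    ⟨⟨Equiv.refl _, fun _ _ _ => Iff.rfl⟩⟩
  exact Nat.card_pos

theorem coeff_eq_mobius_mul_card_copies (G : Crux M) (q : ℕ) :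
    G.coeff q = G.graph.mobius * (G.copies q).card := by
  have : (G.autCard : ℚ) ≠ 0 := Nat.cast_ne_zero.2 G.autCard_pos.ne'
  rw [coeff, ← card_copies_mul_autCard, Nat.cast_mul]
  field_simp

theorem term_eq_sum_copies (G : Crux M) (q n : ℕ) :
    G.term q n = ∑ A ∈ G.copies q, (A.mobius * A.superCount n : ℚ) := by
  have hexp : 2 * q - 2 * G.numComponents - G.codegree = 2 * (q - G.size) := by
    have := G.codegree_add_two_mul_numComponents
    omega
  have hA : ∀ A ∈ G.copies q, (A.mobius * A.superCount n : ℚ) =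
      G.graph.mobius * (truncatedProd G.extents n * n ^ (2 * (q - G.size))) := by
    intro A hA
    obtain ⟨ε, rfl⟩ := mem_copies.1 hA
    rw [AttackGraph.mobius_map, AttackGraph.superCount_map, superCount_eq,
      truncatedProd_eq_prod_sub]
    push_cast
    rfl
  rw [Finset.sum_congr rfl hA, Finset.sum_const, nsmul_eq_mul, term,
    coeff_eq_mobius_mul_card_copies, hexp]
  ring

end Copies

end Crux

/-- A system of representatives of the isomorphism classes of cruxes, sorted by codegree: `T r`
lists the representatives of codegree `r`. -/
structure IsRepresentativeSystem {M : Finset (ℤ × ℤ)} {m : ℕ → ℕ}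
    (T : (r : ℕ) → Fin (m r) → Crux M) : Prop where
  codegree_eq : ∀ r t, (T r t).codegree = r
  existsUnique_iso : ∀ G : Crux M, ∃! t, G.Iso (T G.codegree t)

namespace IsRepresentativeSystem

theorem exists_isRepresentativeSystem (M : Finset (ℤ × ℤ)) :
    ∃ (m : ℕ → ℕ) (T : (r : ℕ) → Fin (m r) → Crux M), IsRepresentativeSystem T := by
  let s (r : ℕ) : Setoid {G : Crux M // G.codegree = r} :=
    ⟨fun G H => G.1.Iso H.1, fun G => .refl G.1, .symm, .trans⟩
  have := Crux.finite_codegree_eq M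
  choose m T hT using fun r => exists_fin_representatives (s r)
  exact ⟨m, fun r t => (T r t).1, fun r t => (T r t).2, fun G => hT _ ⟨G, rfl⟩⟩

variable {M : Finset (ℤ × ℤ)} {m : ℕ → ℕ} {T : (r : ℕ) → Fin (m r) → Crux M}

theorem existsUnique_mem_copies (hT : IsRepresentativeSystem T) {q : ℕ} (A : AttackGraph M q) :
    ∃! rt : Σ r, Fin (m r), A ∈ (T rt.1 rt.2).copies q := by
  obtain ⟨G, hG⟩ := Crux.exists_mem_copies A
  obtain ⟨ε, rfl⟩ := Crux.mem_copies.1 hG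
  obtain ⟨t, ht, huniq⟩ := hT.existsUnique_iso G
  simp only [Crux.map_mem_copies_iff]
  refine ⟨⟨_, t⟩, ht, fun ⟨r, u⟩ hu => ?_⟩
  obtain rfl : G.codegree = r := hu.codegree_eq.trans (hT.codegree_eq r u)
  rw [huniq u hu]

theorem exists_mem_copies_iff_ne_empty (hT : IsRepresentativeSystem T) {q R : ℕ}
    (hR : 2 * q ≤ R) (A : AttackGraph M q) :
    (∃ r ∈ (Finset.Icc 2 R).filter (fun r => Even r), ∃ t, A ∈ (T r t).copies q) ↔
      A ≠ AttackGraph.empty M q := by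
  constructor
  · rintro ⟨r, hr, t, hA⟩
    rw [Ne, Crux.eq_empty_iff_codegree_eq_zero hA, hT.codegree_eq]
    have := (Finset.mem_Icc.1 (Finset.mem_filter.1 hr).1).1
    omega
  · intro hne
    obtain ⟨⟨r, t⟩, hA, -⟩ := hT.existsUnique_mem_copies A
    rw [Ne, Crux.eq_empty_iff_codegree_eq_zero hA, hT.codegree_eq] at hne
    have heven := (T r t).even_codegree
    have hle := Crux.codegree_le_of_mem_copies hA
    rw [hT.codegree_eq] at heven hle
    dsimp only at hne heven hle
    obtain ⟨d, rfl⟩ := heven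
    exact ⟨_, Finset.mem_filter.2 ⟨Finset.mem_Icc.2 ⟨by omega, by omega⟩, d, rfl⟩, t, hA⟩

theorem nonattackingCount_eq (hT : IsRepresentativeSystem T) {q R : ℕ} (hR : 2 * q ≤ R) (n : ℕ) :
    (nonattackingCount M q n : ℚ) = (n : ℚ) ^ (2 * q) +
      ∑ r ∈ (Finset.Icc 2 R).filter (fun r => Even r), ∑ t, (T r t).term q n := by
  classical
  have := attackGraph_finite M q
  have := Fintype.ofFinite (AttackGraph M q)
  have hunion : (((Finset.Icc 2 R).filter fun r => Even r).sigma fun r =>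
      (Finset.univ : Finset (Fin (m r)))).biUnion (fun rt => (T rt.1 rt.2).copies q) =
      Finset.univ.erase (AttackGraph.empty M q) := by
    ext A
    simpa [Sigma.exists, and_assoc] using hT.exists_mem_copies_iff_ne_empty hR A
  have hcount : (nonattackingCount M q n : ℚ) =
      ∑ A : AttackGraph M q, (A.mobius * A.superCount n : ℚ) := by
    exact_mod_cast congrArg (Int.cast : ℤ → ℚ) (nonattackingCount_eq_sum_mobius M q n)
  simp only [Crux.term_eq_sum_copies]
  rw [hcount, ← Finset.add_sum_erase _ _ (Finset.mem_univ (AttackGraph.empty M q)), ← hunion,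
    AttackGraph.mobius_empty, AttackGraph.superCount_empty, Finset.sum_biUnion, Finset.sum_sigma]
  · push_cast
    rw [one_mul]
  · exact fun rt _ rt' _ hne => Finset.disjoint_left.2 fun A hA hA' =>
      hne ((hT.existsUnique_mem_copies A).unique hA hA')

end IsRepresentativeSystem

/-! ### The terms as polynomials -/

namespace Crux

section TermPoly

variable {M : Finset (ℤ × ℤ)} (G : Crux M)

/-- The polynomial `∏ (n - aᵢ)`, where the `aᵢ` are the extents of `G`. -/
noncomputable def extentsPoly : ℚ[X] := ∏ i, (X - C ((G.extents i : ℕ) : ℚ))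

theorem monic_extentsPoly : G.extentsPoly.Monic := monic_prod_X_sub_C _ _

theorem natDegree_extentsPoly : G.extentsPoly.natDegree = 2 * G.numComponents := by
  rw [extentsPoly, natDegree_prod_of_monic _ _ fun i _ => monic_X_sub_C _]
  simp only [natDegree_X_sub_C, Finset.sum_const, Finset.card_univ, Fintype.card_sum, smul_eq_mul,
    mul_one, numComponents, two_mul]

theorem coeff_ne_zero_iff {q : ℕ} : G.coeff q ≠ 0 ↔ G.graph.mobius ≠ 0 ∧ G.size ≤ q := by
  simp [coeff, G.autCard_pos.ne', Nat.descFactorial_eq_zero_iff_lt]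

theorem coeff_eq_zero_of_lt {q : ℕ} (hq : q < G.size) : G.coeff q = 0 := by
  by_contra h
  exact hq.not_ge (G.coeff_ne_zero_iff.1 h).2

theorem termPoly_eq (q : ℕ) :
    G.termPoly q = C (G.coeff q) * (X ^ (2 * (q - G.size)) * G.extentsPoly) := by
  have hexp : 2 * q - 2 * G.numComponents - G.codegree = 2 * (q - G.size) := by
    have := G.codegree_add_two_mul_numComponents
    omega
  rw [termPoly, hexp, mul_assoc, extentsPoly]

theorem termPoly_eq_zero_of_lt_codegree {q : ℕ} (hq : 2 * q < G.codegree) :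
    G.termPoly q = 0 := by
  have := G.codegree_le_two_mul_size
  rw [termPoly_eq, G.coeff_eq_zero_of_lt (by omega), C_0, zero_mul]

theorem degree_termPoly {q : ℕ} (hq : G.coeff q ≠ 0) :
    (G.termPoly q).degree = ((2 * q - G.codegree : ℕ) : WithBot ℕ) := by
  have hmonic : (X ^ (2 * (q - G.size)) * G.extentsPoly).Monic :=
    (monic_X_pow _).mul G.monic_extentsPoly
  have hsize := (G.coeff_ne_zero_iff.1 hq).2
  have := G.codegree_add_two_mul_numComponents
  rw [termPoly_eq, degree_C_mul hq, degree_eq_natDegree hmonic.ne_zero,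
    (monic_X_pow _).natDegree_mul G.monic_extentsPoly, natDegree_X_pow, natDegree_extentsPoly,
    Nat.cast_inj]
  omega

theorem termPoly_eq_zero_or_degree_eq (q : ℕ) :
    G.termPoly q = 0 ∨ (G.termPoly q).degree = ((2 * q - G.codegree : ℕ) : WithBot ℕ) := by
  by_cases hq : G.coeff q = 0
  · left
    rw [termPoly_eq, hq, C_0, zero_mul]
  · exact .inr (G.degree_termPoly hq)

theorem degree_termPoly_le (q : ℕ) :
    (G.termPoly q).degree ≤ ((2 * q - G.codegree : ℕ) : WithBot ℕ) := by
  rcases G.termPoly_eq_zero_or_degree_eq q with h | h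
  · simp only [h, degree_zero, bot_le]
  · exact h.le

/-- The polynomial in `q` whose value is the coefficient of `n ^ (2 * q - s)` in
`G.termPoly q`. -/
noncomputable def coeffPoly (s : ℕ) : ℚ[X] :=
  C ((G.graph.mobius : ℚ) / G.autCard * codegreeCoeff (2 * G.size) s G.extentsPoly) *
    descPochhammer ℚ G.size

theorem eval_coeffPoly (s q : ℕ) :
    (G.coeffPoly s).eval (q : ℚ) = G.coeff q * codegreeCoeff (2 * G.size) s G.extentsPoly := by
  rw [coeffPoly, eval_mul, eval_C, descPochhammer_eval_eq_descFactorial, coeff]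
  ring

theorem codegreeCoeff_two_mul_termPoly (q s : ℕ) :
    codegreeCoeff (2 * q) s (G.termPoly q) = (G.coeffPoly s).eval (q : ℚ) := by
  rw [eval_coeffPoly, termPoly_eq, codegreeCoeff_C_mul]
  rcases lt_or_ge q G.size with hq | hq
  · rw [G.coeff_eq_zero_of_lt hq, zero_mul, zero_mul]
  · obtain ⟨a, rfl⟩ := Nat.exists_eq_add_of_le' hq
    rw [Nat.add_sub_cancel, mul_add, codegreeCoeff_X_pow_mul]

theorem coeffPoly_eq_zero_of_lt_codegree {s : ℕ} (hs : s < G.codegree) : G.coeffPoly s = 0 := by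
  have hdeg : G.extentsPoly.natDegree + s < 2 * G.size := by
    have := G.codegree_add_two_mul_numComponents
    rw [natDegree_extentsPoly]
    omega
  rw [coeffPoly, codegreeCoeff_eq_zero_of_natDegree_add_lt hdeg, mul_zero, C_0, zero_mul]

theorem isTwoLevelPolynomial_termPoly :
    IsTwoLevelPolynomial (C 2 * X - C (G.codegree : ℚ)) (fun _ => ⊤) G.termPoly where
  numerical := isNumericalPolynomial_linear _
  eventuallyNonneg := isEventuallyNonneg_linear _
  degree_eq q d hd := by
    obtain rfl : d = 2 * q - G.codegree :=
      Nat.eq_sub_of_add_eq ((eval_linear_eq_natCast_iff _ _ _).1 hd).symm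
    exact G.termPoly_eq_zero_or_degree_eq q
  eq_zero q hq := G.termPoly_eq_zero_of_lt_codegree ((eval_linear_neg_iff _ _).1 hq)
  coefficients :=
    hasTwoLevelCoefficients_of_codegreeCoeff_two_mul G.codegreeCoeff_two_mul_termPoly _ _

theorem term_eq_eval_termPoly (q : ℕ) {n : ℕ} (hn : maxCoord M * G.codegree ≤ 2 * n) :
    G.term q n = (G.termPoly q).eval (n : ℚ) := by
  have hle (i) : G.extents i ≤ n := by
    have := G.two_mul_extents_le i
    omega
  simp only [term, termPoly, truncatedProd, if_pos hle, eval_mul, eval_C, eval_pow, eval_X,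
    eval_prod, eval_sub]

end TermPoly

section Sums

variable {M : Finset (ℤ × ℤ)} {ι : Type*} {I : Finset ι} {G : ι → Crux M} {r : ℕ}

theorem degree_sum_termPoly_le (hG : ∀ t ∈ I, (G t).codegree = r) (q : ℕ) :
    (∑ t ∈ I, (G t).termPoly q).degree ≤ ((2 * q - r : ℕ) : WithBot ℕ) :=
  (degree_sum_le _ _).trans (Finset.sup_le fun t ht => hG t ht ▸ (G t).degree_termPoly_le q)

theorem sum_termPoly_eq_zero_of_lt (hG : ∀ t ∈ I, (G t).codegree = r) {q : ℕ} (hq : 2 * q < r) :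
    ∑ t ∈ I, (G t).termPoly q = 0 :=
  Finset.sum_eq_zero fun t ht => (G t).termPoly_eq_zero_of_lt_codegree (by rwa [hG t ht])

theorem codegreeCoeff_two_mul_sum_termPoly (I : Finset ι) (G : ι → Crux M) (q s : ℕ) :
    codegreeCoeff (2 * q) s (∑ t ∈ I, (G t).termPoly q) =
      (∑ t ∈ I, (G t).coeffPoly s).eval (q : ℚ) := by
  simp only [codegreeCoeff_sum, eval_finsetSum, codegreeCoeff_two_mul_termPoly]

theorem sum_coeffPoly_eq_zero_of_lt (hG : ∀ t ∈ I, (G t).codegree = r) {s : ℕ} (hs : s < r) :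
    ∑ t ∈ I, (G t).coeffPoly s = 0 :=
  Finset.sum_eq_zero fun t ht => (G t).coeffPoly_eq_zero_of_lt_codegree (by rwa [hG t ht])

theorem sum_term_eq_eval_sum_termPoly (hG : ∀ t ∈ I, (G t).codegree = r) (q : ℕ) {n : ℕ}
    (hn : maxCoord M * r ≤ 2 * n) :
    ∑ t ∈ I, (G t).term q n = (∑ t ∈ I, (G t).termPoly q).eval (n : ℚ) := by
  rw [eval_finsetSum]
  exact Finset.sum_congr rfl fun t ht => (G t).term_eq_eval_termPoly q (by rwa [hG t ht])

end Sums

end Crux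

/-- The polynomial in `n` with which the number of nonattacking placements of `q` pieces agrees for
large `n`, when `T` is a system of representatives of the cruxes. -/
noncomputable def countPoly {M : Finset (ℤ × ℤ)} {m : ℕ → ℕ}
    (T : (r : ℕ) → Fin (m r) → Crux M) (q : ℕ) : ℚ[X] :=
  X ^ (2 * q) + ∑ r ∈ (Finset.Icc 2 (2 * q)).filter (fun r => Even r), ∑ t, (T r t).termPoly q

namespace IsRepresentativeSystem

variable {M : Finset (ℤ × ℤ)} {m : ℕ → ℕ} {T : (r : ℕ) → Fin (m r) → Crux M}

theorem degree_countPoly (hT : IsRepresentativeSystem T) (q : ℕ) :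
    (countPoly T q).degree = ((2 * q : ℕ) : WithBot ℕ) := by
  have hlt : (∑ r ∈ (Finset.Icc 2 (2 * q)).filter (fun r => Even r),
      ∑ t, (T r t).termPoly q).degree < ((2 * q : ℕ) : WithBot ℕ) := by
    refine (degree_sum_le _ _).trans_lt ((Finset.sup_lt_iff (WithBot.bot_lt_coe _)).2 ?_)
    intro r hr
    have hr := Finset.mem_Icc.1 (Finset.mem_filter.1 hr).1
    refine (Crux.degree_sum_termPoly_le (fun t _ => hT.codegree_eq r t) q).trans_lt ?_
    exact Nat.cast_lt.2 (by omega)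
  rw [countPoly, degree_add_eq_left_of_degree_lt (by rwa [degree_X_pow]), degree_X_pow]

theorem nonattackingCount_eq_eval_countPoly (hT : IsRepresentativeSystem T) {q n : ℕ}
    (hn : maxCoord M * q ≤ n) :
    (nonattackingCount M q n : ℚ) = (countPoly T q).eval (n : ℚ) := by
  rw [hT.nonattackingCount_eq le_rfl n, countPoly, eval_add, eval_pow, eval_X, eval_finsetSum]
  refine congrArg _ (Finset.sum_congr rfl fun r hr => ?_)
  have hr := Finset.mem_Icc.1 (Finset.mem_filter.1 hr).1
  refine Crux.sum_term_eq_eval_sum_termPoly (fun t _ => hT.codegree_eq r t) q ?_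
  calc maxCoord M * r ≤ maxCoord M * (2 * q) := Nat.mul_le_mul_left _ hr.2
    _ = 2 * (maxCoord M * q) := mul_left_comm ..
    _ ≤ 2 * n := Nat.mul_le_mul_left _ hn

theorem codegreeCoeff_two_mul_countPoly (hT : IsRepresentativeSystem T) (q s : ℕ) :
    codegreeCoeff (2 * q) s (countPoly T q) = ((if s = 0 then 1 else 0) +
      ∑ r ∈ (Finset.Icc 2 s).filter (fun r => Even r), ∑ t, (T r t).coeffPoly s).eval
        (q : ℚ) := by
  have hcodegree (r) : ∀ t ∈ Finset.univ, (T r t).codegree = r := fun t _ => hT.codegree_eq r t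
  rw [countPoly, codegreeCoeff_add, codegreeCoeff_X_pow, eval_add, codegreeCoeff_sum,
    eval_finsetSum]
  congr 1
  · rw [apply_ite (eval (q : ℚ)), eval_one, eval_zero]
  · refine Finset.sum_congr_of_eq_on_inter (fun r hr hrs => ?_) (fun r hr hrq => ?_)
      fun r _ _ => Crux.codegreeCoeff_two_mul_sum_termPoly _ _ q s
    · have hlt : s < r := by
        simp only [Finset.mem_filter, Finset.mem_Icc] at hr hrs
        grind
      rw [Crux.codegreeCoeff_two_mul_sum_termPoly,
        Crux.sum_coeffPoly_eq_zero_of_lt (hcodegree r) hlt, eval_zero]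
    · have hlt : 2 * q < r := by
        simp only [Finset.mem_filter, Finset.mem_Icc] at hr hrq
        grind
      rw [← Crux.codegreeCoeff_two_mul_sum_termPoly,
        Crux.sum_termPoly_eq_zero_of_lt (hcodegree r) hlt, codegreeCoeff, coeff_zero, ite_self]

theorem isEventualTwoLevelPolynomial_nonattackingCount (hT : IsRepresentativeSystem T) :
    IsEventualTwoLevelPolynomial (C 2 * X) (fun _ => ⊤)
      (fun q n => (nonattackingCount M q n : ℚ)) := by
  have hg : (C 2 * X : ℚ[X]) = C 2 * X - C ((0 : ℕ) : ℚ) := by simp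
  rw [hg]
  refine ⟨isNumericalPolynomial_linear 0, isEventuallyNonneg_linear 0, fun q hq => ?_,
    countPoly T, fun q d hd => ?_,
    hasTwoLevelCoefficients_of_codegreeCoeff_two_mul hT.codegreeCoeff_two_mul_countPoly 0 _⟩
  · exact absurd ((eval_linear_neg_iff q 0).1 hq) (Nat.not_lt_zero _)
  · obtain rfl : 2 * q = d := (eval_linear_eq_natCast_iff q 0 d).1 hd
    exact ⟨hT.degree_countPoly q, (Filter.eventually_ge_atTop (maxCoord M * q)).mono fun n hn =>
      hT.nonattackingCount_eq_eval_countPoly hn⟩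

end IsRepresentativeSystem

theorem mainTheorem11 (M : Finset (ℤ × ℤ)) :
    -- the count is an eventual two-level polynomial of degree `2q` and infinite depth
    IsEventualTwoLevelPolynomial (C 2 * X) (fun _ => ⊤)
      (fun q n => (nonattackingCount M q n : ℚ)) ∧
    -- for each codegree there are finitely many types of cruxes, and the formula sums over them
    ∃ (m : ℕ → ℕ) (T : (r : ℕ) → Fin (m r) → Crux M),
      (∀ r, (∀ t, (T r t).codegree = r) ∧
        ∀ G : Crux M, G.codegree = r → ∃! t, G.Iso (T r t)) ∧
      -- the formula; summands with `r > 2q` vanish, so any `R ≥ 2q` gives the full sum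
      (∀ q n R : ℕ, 2 * q ≤ R →
        (nonattackingCount M q n : ℚ) = (n : ℚ) ^ (2 * q) +
          ∑ r ∈ (Finset.Icc 2 R).filter (fun r => Even r), ∑ t, (T r t).term q n) ∧
      -- each term of codegree `r` agrees with a two-level polynomial of degree `2q - r` and
      -- infinite depth for `n ≥ w r / 2`
      (∀ r t,
        (∀ i, 2 * (T r t).extents i ≤ maxCoord M * r) ∧
        IsTwoLevelPolynomial (C 2 * X - C (r : ℚ)) (fun _ => ⊤) (T r t).termPoly ∧
        (∀ q, (T r t).graph.mobius ≠ 0 → (T r t).size ≤ q →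
          ((T r t).termPoly q).degree = ((2 * q - r : ℕ) : WithBot ℕ)) ∧
        ∀ q n : ℕ, maxCoord M * r ≤ 2 * n →
          (T r t).term q n = ((T r t).termPoly q).eval (n : ℚ)) ∧
      -- the same for the sum of all terms of codegree `r`, whose leading terms might cancel
      ∀ r,
        (∀ q, r ≤ 2 * q →
          (∑ t, (T r t).termPoly q).degree ≤ ((2 * q - r : ℕ) : WithBot ℕ)) ∧
        (∀ q, 2 * q < r → ∑ t, (T r t).termPoly q = 0) ∧
        HasTwoLevelCoefficients (C 2 * X - C (r : ℚ)) (fun _ => ⊤)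
          (fun q => ∑ t, (T r t).termPoly q) ∧
        ∀ q n : ℕ, maxCoord M * r ≤ 2 * n →
          ∑ t, (T r t).term q n = (∑ t, (T r t).termPoly q).eval (n : ℚ) := by
  obtain ⟨m, T, hT⟩ := IsRepresentativeSystem.exists_isRepresentativeSystem M
  have hcodegree (r) : ∀ t ∈ Finset.univ, (T r t).codegree = r := fun t _ => hT.codegree_eq r t
  refine ⟨hT.isEventualTwoLevelPolynomial_nonattackingCount, m, T, fun r => ⟨hT.codegree_eq r, ?_⟩,
    fun q n R hR => hT.nonattackingCount_eq hR n, fun r t => ?_, fun r => ?_⟩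
  · rintro G rfl
    exact hT.existsUnique_iso G
  · generalize T r t = G, hT.codegree_eq r t = hG
    subst hG
    exact ⟨G.two_mul_extents_le, G.isTwoLevelPolynomial_termPoly,
      fun q hμ hq => G.degree_termPoly (G.coeff_ne_zero_iff.2 ⟨hμ, hq⟩),
      fun q n => G.term_eq_eval_termPoly q⟩
  · exact ⟨fun q _ => Crux.degree_sum_termPoly_le (hcodegree r) q,
      fun q => Crux.sum_termPoly_eq_zero_of_lt (hcodegree r),
      hasTwoLevelCoefficients_of_codegreeCoeff_two_mul
        (Crux.codegreeCoeff_two_mul_sum_termPoly _ _) r _,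
      fun q n => Crux.sum_term_eq_eval_sum_termPoly (hcodegree r) q⟩
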